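/- **Definitions.** A 3SAT formula $\Phi$ with variables $x_1,\dots,x_n$ and clauses $C_1,\dots,C_m$ is a conjunction of $m$ clauses, each a disjunction of at most three literals; $\mathrm{SAT}(\Phi)\subseteq\mathbb R^n$ is the convex hull of the vectors $x\in\{0,1\}^n$ that satisfy $\Phi$. For a finite set or finite family $A=(a_i)_{i\in I}$ of integers and an integer $b$, let $$\mathrm{SUBSETSUM}(A,b)=\operatorname{conv}\Big\{x\in\{0,1\}^I : \sum_{i\in I} a_ix_i=b\Big\},\qquad \mathrm{KNAPSACK}(A,b)=\operatorname{conv}\Big\{x\in\{0,1\}^I : \sum_{i\in I} a_ix_i\le b\Big\}.$$ The extension complexity $\mathrm{xc}(P)$ of a polytope $P$ is the minimum number of facets (nonempty faces of codimension one) of a polytope $Q\subseteq\mathbb R^e$, $e$ arbitrary, of which $P$ is the image under a linear map. For a 3SAT formula $\Phi$ as above define integers with $n+m$ decimal digits, the digit in position $1$ being the most significant: for $1\le i\le n$, $v_i$ (respectively $v'_i$) has digit $1$ in position $i$ and in each position $n+j$ such that $x_i\in C_j$ (respectively $\overline{x}_i\in C_j$), and digit $0$ elsewhere; for $1\le j\le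 m$, $s_j$ (respectively $s'_j$) has digit $1$ (respectively $2$) in position $n+j$ and $0$ elsewhere; $b$ has digit $1$ in positions $1,\dots,n$ and digit $4$ in positions $n+1,\dots,n+m$. Let $A(\Phi)$ be the family $(v_1,\dots,v_n,v'_1,\dots,v'_n,s_1,\dots,s_m,s'_1,\dots,s'_m)$. **Theorem.** 1. For every 3SAT formula $\Phi$ with $n$ variables and $m$ clauses, the family $A(\Phi)$ has $2n+2m$ members, and $\mathrm{SAT}(\Phi)$ is the image of $\mathrm{SUBSETSUM}(A(\Phi),b)$ under the coordinate projection that keeps exactly the coordinates of $v_1,\dots,v_n$. The members of $A(\Phi)$ are pairwise distinct if and only if for every variable $x_i$ there is a clause that contains exactly one of the literals $x_i,\overline{x}_i$. 2. For every 3SAT formula $\Phi$ with $n$ variables and $m$ clauses there are a set $A$ of exactly $2n+2m$ (distinct) integers and an integer $b$ such that $\mathrm{SAT}(\Phi)$ is the image of $\mathrm{SUBSETSUM}(A,b)$ under the projection to some $n$ distinct coordinates. 3. For every finite family $A$ of integers and every integer $b$, $\mathrm{SUBSETSUM}(A,b)$ is a (possibly empty) face of $\mathrm{KNAPSACK}(A,b)$.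 4. There are constants $c>0$ and $C$ such that for every natural number $n\ge1$ there are a set $A$ of at most $Cn$ positive integers and an integer $b$ with $$\mathrm{xc}(\mathrm{SUBSETSUM}(A,b))\ge 2^{c\sqrt n}\qquad\text{and}\qquad \mathrm{xc}(\mathrm{KNAPSACK}(A,b))\ge 2^{c\sqrt n}.$$ -/

import Mathlib

open scoped ENNReal

/-- A polytope: the convex hull of a finite set of points. -/
def IsPolytope {E : Type*} [AddCommGroup E] [Module ℝ E] (Q : Set E) : Prop :=
  ∃ V : Set E, V.Finite ∧ Q = convexHull ℝ V

/-- The facets of `Q`: the nonempty faces whose dimension is one less than that of `Q`. Faces of a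
polytope are its exposed subsets. The dimension of a nonempty set is that of its affine hull,
i.e. the rank of `vectorSpan`. -/
def facets {E : Type*} [AddCommGroup E] [Module ℝ E] [TopologicalSpace E] (Q : Set E) :
    Set (Set E) :=
  {F | F.Nonempty ∧ IsExposed ℝ Q F ∧
    Module.finrank ℝ (vectorSpan ℝ F) + 1 = Module.finrank ℝ (vectorSpan ℝ Q)}

/-- The extension complexity of `P`: the least number of facets of a polytope `Q ⊆ ℝ^e`
(`e` arbitrary) of which `P` is the image under a linear map. -/
noncomputable def extensionComplexity {E : Type*} [AddCommGroup E] [Module ℝ E] (P : Set E) : ℕ∞ :=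
  ⨅ (e : ℕ) (Q : Set (Fin e → ℝ)) (T : (Fin e → ℝ) →ₗ[ℝ] E)
    (_ : IsPolytope Q) (_ : T '' Q = P), (facets Q).encard

/-- The convex hull of the characteristic vectors of the subsets of `ι` over which `a` sums to
`b`. For a set `A` of integers, `a` is the inclusion of `A` into `ℤ`. -/
def subsetSumPolytope {ι : Type*} [Fintype ι] (a : ι → ℤ) (b : ℤ) : Set (ι → ℝ) :=
  convexHull ℝ {x | (∀ i, x i = 0 ∨ x i = 1) ∧ ∑ i, (a i : ℝ) * x i = (b : ℝ)}

/-- The convex hull of the characteristic vectors of the subsets of `ι` over which `a` sums to at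
most `b`. -/
def knapsackPolytope {ι : Type*} [Fintype ι] (a : ι → ℤ) (b : ℤ) : Set (ι → ℝ) :=
  convexHull ℝ {x | (∀ i, x i = 0 ∨ x i = 1) ∧ ∑ i, (a i : ℝ) * x i ≤ (b : ℝ)}

/-- A 3SAT formula with `n` variables and `m` clauses, each a set of at most three literals;
`(i, true)` is the literal `x_i` and `(i, false)` its negation. -/
structure ThreeSATFormula (n m : ℕ) where
  clause : Fin m → Finset (Fin n × Bool)
  card_clause_le : ∀ j, (clause j).card ≤ 3

namespace ThreeSATFormula

/-- The 0/1 vector `x` satisfies `Φ`: every clause contains a literal that is true at `x`. -/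
def IsSatisfiedBy {n m : ℕ} (Φ : ThreeSATFormula n m) (x : Fin n → ℝ) : Prop :=
  ∀ j, ∃ l ∈ Φ.clause j, x l.1 = if l.2 then 1 else 0

/-- `SAT(Φ)`: the convex hull of the satisfying 0/1 assignments. -/
def satPolytope {n m : ℕ} (Φ : ThreeSATFormula n m) : Set (Fin n → ℝ) :=
  convexHull ℝ {x | (∀ i, x i = 0 ∨ x i = 1) ∧ Φ.IsSatisfiedBy x}

end ThreeSATFormula

/-- The number written in base 10 with the `k` digits `d 0, …, d (k - 1)`, most significant digit
first. -/
def ofDecimal {k : ℕ} (d : Fin k → ℕ) : ℕ :=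
  ∑ j, d j * 10 ^ (j.rev : ℕ)

namespace ThreeSATFormula

/-- The number of the literal `l`: its digit at position `l.1` is 1, the other variable digits
are 0, and its digit for a clause is 1 or 0 according as `l` belongs to that clause or not. So
`v_i` is `literalNumber (i, true)` and `v'_i` is `literalNumber (i, false)`. -/
def literalNumber {n m : ℕ} (Φ : ThreeSATFormula n m) (l : Fin n × Bool) : ℕ :=
  ofDecimal (Fin.append (fun i : Fin n => if i = l.1 then 1 else 0)
    (fun j : Fin m => if l ∈ Φ.clause j then 1 else 0))

/-- The number all of whose digits are 0, except for the digit `d` at clause `j`. So `s_j` is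
`slackNumber n j 1` and `s'_j` is `slackNumber n j 2`. -/
def slackNumber (n : ℕ) {m : ℕ} (j : Fin m) (d : ℕ) : ℕ :=
  ofDecimal (Fin.append (fun _ : Fin n => 0) (fun j' : Fin m => if j' = j then d else 0))

/-- The family `A(Φ) = (v_1, …, v_n, v'_1, …, v'_n, s_1, …, s_m, s'_1, …, s'_m)`. -/
def numbers {n m : ℕ} (Φ : ThreeSATFormula n m) : (Fin n ⊕ Fin n) ⊕ (Fin m ⊕ Fin m) → ℤ :=
  Sum.elim
    (Sum.elim (fun i => (Φ.literalNumber (i, true) : ℤ)) (fun i => (Φ.literalNumber (i, false) : ℤ)))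
    (Sum.elim (fun j => (slackNumber n j 1 : ℤ)) (fun j => (slackNumber n j 2 : ℤ)))

/-- The target `b`: the digit of every variable is 1 and that of every clause is 4. -/
def target (n m : ℕ) : ℤ :=
  (ofDecimal (Fin.append (fun _ : Fin n => 1) (fun _ : Fin m => 4)) : ℤ)

end ThreeSATFormula

/-! The reduction rests on decimal addition without carries: at a 0/1 vector every digit of the sum
minus the target has absolute value at most 9, so the single equation splits into one equation per
digit. A variable digit forces exactly one of `v_i`, `v'_i`; a clause digit 4 is reachable exactly
when a chosen literal helps, since the slacks contribute at most 3. Projections commute with convex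
hulls, so this passes to the polytopes.

For the lower bound, let `Q` project onto `P` and suppose that subsets `a`, `b` of a `k`-set index
valid inequalities and points of `P`, with tightness exactly when `|a ∩ b| = 1`. If `a` is nonempty
and disjoint from `b`, some facet of `Q` contains the face of `a` and misses a chosen preimage of
the point of `b` (`IsPolytope.exists_facet`). So each facet defines a combinatorial rectangle
without pairs meeting in one element, and these rectangles cover all such disjoint pairs. There are
`3 ^ k` disjoint pairs, and one rectangle holds at most `2 ^ k` of them
(`sum_sum_disjoint_rectangle_le`), so about `(3 / 2) ^ k` facets are needed.

Such a system arises from the formula saying `z_{i,j} = b_i ∧ b_j`: the inequality `(∑ i ∈ a, b_i -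
1) ^ 2 ≥ 0` becomes linear in `b` and `z`. A multiple of the weight functional extends it from the
subset-sum face to the whole knapsack polytope. The formula has `O(k ^ 2)` variables and clauses,
whence the exponent `√n`. -/

/-! ### Facets of polytopes -/

/-- Values of a linear functional on a convex hull are bounded by a common bound on the generators. -/
theorem LinearMap.le_of_mem_convexHull {E : Type*} [AddCommGroup E] [Module ℝ E] {S : Set E}
    {l : E →ₗ[ℝ] ℝ} {M : ℝ} (h : ∀ x ∈ S, l x ≤ M) {x : E} (hx : x ∈ convexHull ℝ S) : l x ≤ M :=
  convexHull_min (t := {x | l x ≤ M}) h (convex_halfSpace_le l.isLinear M) hx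

theorem LinearMap.eq_of_sub_mem_vectorSpan {E : Type*} [AddCommGroup E] [Module ℝ E] {S : Set E}
    {l : E →ₗ[ℝ] ℝ} (h : vectorSpan ℝ S ≤ LinearMap.ker l) {x y : E} (hx : x ∈ S) (hy : y ∈ S) :
    l x = l y := by
  have := h (vsub_mem_vectorSpan ℝ hx hy)
  rw [LinearMap.mem_ker, vsub_eq_sub, map_sub] at this
  linarith

theorem LinearMap.vectorSpan_le_ker {E : Type*} [AddCommGroup E] [Module ℝ E] {S : Set E}
    {l : E →ₗ[ℝ] ℝ} {M : ℝ} (h : ∀ x ∈ S, l x = M) : vectorSpan ℝ S ≤ LinearMap.ker l := by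
  rw [vectorSpan_def, Submodule.span_le]
  rintro _ ⟨x, hx, y, hy, rfl⟩
  simp [h x hx, h y hy]

/-- A linear functional that is constant on `F` and at `q`, but not on `V`, can be used to rotate a
supporting hyperplane about `F` and `q` until it meets a further point of `V`. -/
theorem exists_rotated_functional {E : Type*} [AddCommGroup E] [Module ℝ E] {V : Set E}
    (hV : V.Finite) {l f : E →ₗ[ℝ] ℝ} {M : ℝ} (hl : ∀ v ∈ V, l v ≤ M) {p w : E} (hw : w ∈ V)
    (hf : 0 < f w - f p) :
    ∃ t : ℝ, (∀ v ∈ V, (l + t • f) v ≤ M + t * f p) ∧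
      ∃ v ∈ V, f v ≠ f p ∧ (l + t • f) v = M + t * f p := by
  -- Ratio test: among the points where `f` exceeds `f p`, the first one whose inequality becomes
  -- tight as `t` grows.
  obtain ⟨v, ⟨hvV, hv⟩, hmin⟩ := Set.exists_min_image {v ∈ V | 0 < f v - f p}
    (fun v => (M - l v) / (f v - f p)) (hV.subset fun _ h => h.1) ⟨w, hw, hf⟩
  refine ⟨(M - l v) / (f v - f p), fun u hu => ?_, v, hvV, fun h => by simp [h] at hv, ?_⟩
  · have key : (M - l v) / (f v - f p) * (f u - f p) ≤ M - l u := by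
      rcases le_or_gt (f u - f p) 0 with h | h
      · exact (mul_nonpos_of_nonneg_of_nonpos
          (div_nonneg (sub_nonneg.2 (hl v hvV)) hv.le) h).trans (sub_nonneg.2 (hl u hu))
      · exact (le_div_iff₀ h).1 (hmin u ⟨hu, h⟩)
    rw [mul_sub] at key
    simp only [LinearMap.add_apply, LinearMap.smul_apply, smul_eq_mul]
    linarith
  · have key : (M - l v) / (f v - f p) * (f v - f p) = M - l v := div_mul_cancel₀ _ hv.ne'
    rw [mul_sub] at key
    simp only [LinearMap.add_apply, LinearMap.smul_apply, smul_eq_mul]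
    linarith

/-- A face of a polytope and a point of the polytope outside of it are separated by a facet. -/
theorem IsPolytope.exists_facet {E : Type*} [NormedAddCommGroup E] [NormedSpace ℝ E]
    [FiniteDimensional ℝ E] {Q : Set E} (hQ : IsPolytope Q) {l : E →ₗ[ℝ] ℝ} {M : ℝ}
    (hl : ∀ x ∈ Q, l x ≤ M) {p q : E} (hp : p ∈ Q) (hlp : l p = M) (hq : q ∈ Q) (hlq : l q < M) :
    ∃ F ∈ facets Q, (∀ x ∈ Q, l x = M → x ∈ F) ∧ q ∉ F := by
  obtain ⟨V, hV, rfl⟩ := hQ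
  -- The generators on supporting hyperplanes that contain the given face and avoid `q`; a maximal
  -- such set will span a facet.
  let 𝒮 : Set (Set E) := {S | ∃ (l' : E →ₗ[ℝ] ℝ) (M' : ℝ), (∀ x ∈ V, l' x ≤ M') ∧
    (∀ x ∈ convexHull ℝ V, l x = M → l' x = M') ∧ l' q < M' ∧ S = {v ∈ V | l' v = M'}}
  have hfin : 𝒮.Finite := hV.finite_subsets.subset (by
    rintro _ ⟨l', M', -, -, -, rfl⟩
    exact fun _ h => h.1)
  obtain ⟨S, ⟨l', M', hl', hG, hq', rfl⟩, hmax⟩ := hfin.exists_maximal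
    ⟨_, l, M, fun x hx => hl x (subset_convexHull ℝ V hx), fun _ _ h => h, hlq, rfl⟩
  have hQ' : ∀ x ∈ convexHull ℝ V, l' x ≤ M' := fun x hx => LinearMap.le_of_mem_convexHull hl' hx
  set F : Set E := {x ∈ convexHull ℝ V | l' x = M'} with hF
  have hpF : p ∈ F := ⟨hp, hG p hp hlp⟩
  have hqF : q ∉ F := fun h => hq'.ne h.2
  have hker : vectorSpan ℝ F ≤ LinearMap.ker l' := LinearMap.vectorSpan_le_ker fun x hx => hx.2
  have hqp : q - p ∉ vectorSpan ℝ F := fun h => by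
    have := hker h
    rw [LinearMap.mem_ker, map_sub, hpF.2] at this
    linarith
  -- `F` has codimension one: a generator outside the span of `F` and `q` would allow a rotation
  -- about `F` and `q` that picks up a new generator, against maximality.
  have hW : ∀ v ∈ V, v - p ∈ vectorSpan ℝ F ⊔ Submodule.span ℝ {q - p} := by
    intro w hw
    by_contra hwW
    obtain ⟨g, hg, hgW⟩ := Submodule.exists_le_ker_of_notMem hwW
    -- Scaling `g` by its own value at `w - p` makes that value a positive square.
    let f : E →ₗ[ℝ] ℝ := g (w - p) • g
    have hf : 0 < f w - f p := by
      rw [← map_sub]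
      exact mul_self_pos.2 hg
    have hfW : vectorSpan ℝ F ⊔ Submodule.span ℝ {q - p} ≤ LinearMap.ker f := fun x hx => by
      simp [f, LinearMap.mem_ker.1 (hgW hx)]
    have hfF : ∀ x ∈ F, f x = f p := fun x hx =>
      LinearMap.eq_of_sub_mem_vectorSpan (le_sup_left.trans hfW) hx hpF
    have hfq : f q = f p := by
      have : q - p ∈ LinearMap.ker f :=
        hfW (Submodule.mem_sup_right (Submodule.mem_span_singleton_self _))
      rwa [LinearMap.mem_ker, map_sub, sub_eq_zero] at this
    obtain ⟨t, ht, v, hvV, hv, hvt⟩ := exists_rotated_functional hV hl' hw hf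
    have hmem : {v ∈ V | (l' + t • f) v = M' + t * f p} ∈ 𝒮 :=
      ⟨_, _, ht, fun x hx hxM => by simp [hG x hx hxM, hfF x ⟨hx, hG x hx hxM⟩],
        by simpa [hfq] using hq', rfl⟩
    have hv' := hmax hmem (fun u hu => ⟨hu.1, by
      simp [hu.2, hfF u ⟨subset_convexHull ℝ V hu.1, hu.2⟩]⟩) ⟨hvV, hvt⟩
    exact hv (hfF v ⟨subset_convexHull ℝ V hvV, hv'.2⟩)
  have hspan : vectorSpan ℝ (convexHull ℝ V) = vectorSpan ℝ F ⊔ Submodule.span ℝ {q - p} := by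
    apply le_antisymm
    · have hsub : ∀ x ∈ convexHull ℝ V, x - p ∈ vectorSpan ℝ F ⊔ Submodule.span ℝ {q - p} := by
        intro x hx
        refine convexHull_min (t := (fun x => x - p) ⁻¹'
          (vectorSpan ℝ F ⊔ Submodule.span ℝ {q - p} : Submodule ℝ E)) hW ?_ hx
        simp only [sub_eq_add_neg]
        exact (Submodule.convex _).translate_preimage_left _
      rw [vectorSpan_def, Submodule.span_le]
      rintro _ ⟨x, hx, y, hy, rfl⟩
      simpa using Submodule.sub_mem _ (hsub x hx) (hsub y hy)
    · refine sup_le (vectorSpan_mono ℝ fun x hx => hx.1) ?_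
      rw [Submodule.span_singleton_le_iff_mem]
      exact vsub_mem_vectorSpan ℝ hq hp
  refine ⟨F, ⟨⟨p, hpF⟩, fun _ => ⟨LinearMap.toContinuousLinearMap l', ?_⟩, ?_⟩,
    fun x hx hxM => ⟨hx, hG x hx hxM⟩, hqF⟩
  · ext x
    simp only [hF, Set.mem_ofPred_eq, LinearMap.coe_toContinuousLinearMap']
    refine and_congr_right fun hx => ⟨fun h y hy => h ▸ hQ' y hy, fun h => ?_⟩
    exact le_antisymm (hQ' x hx) (hpF.2 ▸ h p hp)
  · rw [hspan, Submodule.finrank_sup_span_singleton hqp]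

/-! ### Counting disjoint pairs, and the facet bound -/

/-- Each element of `s` has three options: in `a` only, in `b` only, or in neither. -/
theorem sum_sum_disjoint_powerset {α : Type*} [DecidableEq α] (s : Finset α) :
    ∑ a ∈ s.powerset, ∑ b ∈ s.powerset, (if Disjoint a b then 1 else 0) = 3 ^ s.card := by
  induction s using Finset.induction_on with
  | empty => simp
  | insert x s hx ih =>
    have hd : ∀ a ∈ s.powerset, x ∉ a := fun a ha h => hx (Finset.mem_powerset.1 ha h)
    rw [Finset.sum_powerset_insert hx, Finset.card_insert_of_notMem hx, pow_succ, ← ih,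
      ← Finset.sum_add_distrib, Finset.sum_mul]
    refine Finset.sum_congr rfl fun a ha => ?_
    rw [Finset.sum_powerset_insert hx, Finset.sum_powerset_insert hx, ← Finset.sum_add_distrib,
      ← Finset.sum_add_distrib, ← Finset.sum_add_distrib, Finset.sum_mul]
    refine Finset.sum_congr rfl fun b hb => ?_
    simp only [Finset.disjoint_insert_left, Finset.disjoint_insert_right, hd a ha, hd b hb,
      Finset.mem_insert, true_or, not_true_eq_false, not_false_eq_true, false_and, true_and]
    split_ifs <;> simp_all

open scoped Classical in
/-- A rectangle of pairs of sets that never meet in exactly one element contains at most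
`2 ^ |s|` pairs of disjoint subsets of `s`. -/
theorem sum_sum_disjoint_rectangle_le {α : Type*} (s : Finset α)
    (A B : Finset α → Prop)
    (h : ∀ a ⊆ s, ∀ b ⊆ s, A a → B b → (a ∩ b).card ≠ 1) :
    ∑ a ∈ s.powerset, ∑ b ∈ s.powerset, (if A a ∧ B b ∧ Disjoint a b then 1 else 0) ≤
      2 ^ s.card := by
  induction s using Finset.induction_on generalizing A B with
  | empty =>
    simp only [Finset.powerset_empty, Finset.sum_singleton, Finset.card_empty, pow_zero]
    split_ifs <;> simp
  | insert x s hx ih =>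
    have hd : ∀ a ⊆ s, x ∉ a := fun a ha h => hx (ha h)
    have hs : ∀ a ⊆ s, a ⊆ insert x s := fun a ha => ha.trans (Finset.subset_insert x s)
    have hi : ∀ a ⊆ s, insert x a ⊆ insert x s := fun a ha => Finset.insert_subset_insert x ha
    -- A disjoint pair `(a, b)` in `s` has three disjoint lifts by `x`. The lift adding `x` to both
    -- sides meets in `x` alone, so `A (insert x a)` and `B (insert x b)` cannot both hold. Hence
    -- the lifts in the rectangle number at most the memberships of `(a, b)` in two rectangles over
    -- `s`, one letting `x` join `a`, the other letting it join `b`.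
    have h1 := ih (fun a => A a ∨ A (insert x a)) B fun a ha b hb hA hB => by
      rcases hA with hA | hA
      · exact h a (hs a ha) b (hs b hb) hA hB
      · simpa [Finset.insert_inter_of_notMem (hd b hb)] using h _ (hi a ha) b (hs b hb) hA hB
    have h2 := ih A (fun b => B b ∨ B (insert x b)) fun a ha b hb hA hB => by
      rcases hB with hB | hB
      · exact h a (hs a ha) b (hs b hb) hA hB
      · simpa [Finset.inter_insert_of_notMem (hd a ha)] using h a (hs a ha) _ (hi b hb) hA hB
    rw [Finset.card_insert_of_notMem hx, pow_succ, mul_two]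
    refine le_trans ?_ (add_le_add h1 h2)
    rw [Finset.sum_powerset_insert hx, ← Finset.sum_add_distrib, ← Finset.sum_add_distrib]
    refine Finset.sum_le_sum fun a ha => ?_
    rw [Finset.sum_powerset_insert hx, Finset.sum_powerset_insert hx, ← Finset.sum_add_distrib,
      ← Finset.sum_add_distrib, ← Finset.sum_add_distrib, ← Finset.sum_add_distrib]
    refine Finset.sum_le_sum fun b hb => ?_
    rw [Finset.mem_powerset] at ha hb
    by_cases hab : Disjoint a b
    · have h3 : ¬ (A (insert x a) ∧ B (insert x b)) := fun ⟨hA, hB⟩ =>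
        h _ (hi a ha) _ (hi b hb) hA hB (by
          rw [← Finset.insert_inter_distrib, Finset.disjoint_iff_inter_eq_empty.1 hab]; rfl)
      simp only [Finset.disjoint_insert_left, Finset.disjoint_insert_right, hd a ha, hd b hb,
        Finset.mem_insert, true_or, not_true_eq_false, not_false_eq_true, hab,
        and_true, and_false, if_false]
      clear h h1 h2 ih
      generalize A a = P, A (insert x a) = P', B b = R, B (insert x b) = R' at *
      by_cases hP : P <;> by_cases hP' : P' <;> by_cases hR : R <;> by_cases hR' : R' <;>
        simp_all
    · simp [Finset.disjoint_insert_left, Finset.disjoint_insert_right, hab]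

open scoped Classical in
/-- Suppose that linear inequalities valid on `S` and points of `S` are indexed by the subsets of
a `k`-element set, and that the inequality of `a` is tight at the point of `b` exactly when `a` and
`b` meet in one element. Then `convexHull ℝ S` has large extension complexity. -/
theorem le_extensionComplexity_convexHull {E : Type*} [AddCommGroup E] [Module ℝ E] {k : ℕ}
    {S : Set E} {L : Finset (Fin k) → E →ₗ[ℝ] ℝ} {β : Finset (Fin k) → ℝ}
    {x : Finset (Fin k) → E} (hx : ∀ b, x b ∈ S) (hL : ∀ a, ∀ y ∈ S, L a y ≤ β a)
    (htight : ∀ a b, L a (x b) = β a ↔ (a ∩ b).card = 1) {N : ℕ} (hN : 2 ^ k * N < 3 ^ k) :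
    (N : ℕ∞) ≤ extensionComplexity (convexHull ℝ S) := by
  refine le_iInf fun e => le_iInf fun Q => le_iInf fun T => le_iInf fun hQ => le_iInf fun hT => ?_
  by_cases hfin : (facets Q).Finite
  swap
  · rw [Set.encard_eq_top_iff.2 hfin]
    exact le_top
  obtain ⟨𝓕, h𝓕⟩ := hfin.exists_finset_coe
  rw [← h𝓕, Set.encard_coe_eq_coe_finsetCard, Nat.cast_le]
  have hq : ∀ b, ∃ q ∈ Q, T q = x b := fun b => by
    have := subset_convexHull ℝ S (hx b)
    rwa [← hT] at this
  choose q hqQ hqx using hq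
  have hQL : ∀ a, ∀ y ∈ Q, (L a ∘ₗ T) y ≤ β a := fun a y hy =>
    LinearMap.le_of_mem_convexHull (hL a) (hT ▸ Set.mem_image_of_mem T hy)
  -- The rectangle of a facet `F`: faces contained in `F` against points off `F`. The empty `a` is
  -- excluded because its inequality need not be tight anywhere; this costs the `2 ^ k` pairs
  -- counted in `hempty`.
  let A : Set (Fin e → ℝ) → Finset (Fin k) → Prop := fun F a =>
    a.Nonempty ∧ ∀ y ∈ Q, (L a ∘ₗ T) y = β a → y ∈ F
  let B : Set (Fin e → ℝ) → Finset (Fin k) → Prop := fun F b => q b ∉ F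
  have hcover : ∀ a b, Disjoint a b → a.Nonempty → ∃ F ∈ 𝓕, A F a ∧ B F b ∧ Disjoint a b := by
    rintro a b hab ⟨i, hi⟩
    have hab' : L a (x b) < β a := lt_of_le_of_ne (hL a _ (hx b)) fun h => by
      simpa [Finset.disjoint_iff_inter_eq_empty.1 hab] using (htight a b).1 h
    -- A singleton inside `a` supplies a point on the face of `a`.
    have hai : L a (x {i}) = β a := (htight a {i}).2 (by simp [hi])
    obtain ⟨F, hF, hF1, hF2⟩ := hQ.exists_facet (hQL a) (hqQ {i})
      (by simpa [hqx] using hai) (hqQ b) (by simpa [hqx] using hab')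
    exact ⟨F, by rwa [← Finset.mem_coe, h𝓕], ⟨⟨i, hi⟩, hF1⟩, hF2, hab⟩
  have hrect : ∀ F, ∑ a : Finset (Fin k), ∑ b : Finset (Fin k),
      (if A F a ∧ B F b ∧ Disjoint a b then 1 else 0) ≤ 2 ^ k := by
    intro F
    have := sum_sum_disjoint_rectangle_le (Finset.univ : Finset (Fin k)) (A F) (B F)
      fun a _ b _ hA hB hab => hB (hA.2 _ (hqQ b) (by
        simpa [hqx] using (htight a b).2 (by convert hab)))
    simp only [Finset.powerset_univ, Finset.card_univ, Fintype.card_fin] at this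
    convert this
  have htotal : ∑ a : Finset (Fin k), ∑ b : Finset (Fin k), (if Disjoint a b then 1 else 0) =
      3 ^ k := by
    simpa using sum_sum_disjoint_powerset (Finset.univ : Finset (Fin k))
  have hempty : ∑ a : Finset (Fin k), ∑ _b : Finset (Fin k), (if a = ∅ then 1 else 0) = 2 ^ k := by
    simp
  have hle : 3 ^ k ≤ 2 ^ k + ∑ F ∈ 𝓕, 2 ^ k := by
    refine le_trans ?_ (add_le_add hempty.le (Finset.sum_le_sum fun F _ => hrect F))
    rw [← htotal, Finset.sum_comm (s := 𝓕), ← Finset.sum_add_distrib]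
    refine Finset.sum_le_sum fun a _ => ?_
    rw [Finset.sum_comm (s := 𝓕), ← Finset.sum_add_distrib]
    refine Finset.sum_le_sum fun b _ => ?_
    by_cases hab : Disjoint a b
    · rcases a.eq_empty_or_nonempty with rfl | ha
      · simp
      · obtain ⟨F, hF, hFab⟩ := hcover a b hab ha
        have := Finset.single_le_sum
          (f := fun F => if A F a ∧ B F b ∧ Disjoint a b then 1 else 0)
          (fun _ _ => Nat.zero_le _) hF
        rw [if_pos hFab] at this
        rw [if_pos hab]
        omega
    · simp [hab]
  rw [Finset.sum_const, smul_eq_mul] at hle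
  have : 2 ^ k * N < 2 ^ k * (𝓕.card + 1) := by linarith
  exact Nat.lt_succ_iff.1 (lt_of_mul_lt_mul_left this (Nat.zero_le _))

/-! ### Decimal digits without carries -/

/-- The last digit is a multiple of ten of absolute value at most 9, hence zero; divide by ten and
repeat. Signed digits are allowed so that the lemma applies to differences. -/
theorem eq_zero_of_sum_mul_ten_pow_eq_zero {k : ℕ} {d : Fin k → ℤ} (hd : ∀ j, |d j| ≤ 9)
    (h : ∑ j, d j * 10 ^ (j.rev : ℕ) = 0) : d = 0 := by
  induction k with
  | zero => exact Subsingleton.elim _ _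
  | succ k ih =>
    have hsum : 10 * ∑ j : Fin k, d j.castSucc * 10 ^ (j.rev : ℕ) + d (Fin.last k) = 0 := by
      rw [Fin.sum_univ_castSucc] at h
      simp only [Fin.rev_castSucc, Fin.val_succ, pow_succ, Fin.rev_last, Fin.val_zero, pow_zero,
        mul_one] at h
      rw [Finset.mul_sum, ← h]
      congr 1
      exact Finset.sum_congr rfl fun _ _ => by ring
    have hlast := abs_le.1 (hd (Fin.last k))
    have h0 := ih (d := fun j => d j.castSucc) (fun j => hd _) (by omega)
    funext j
    refine Fin.lastCases (by simp only [Pi.zero_apply]; omega) (fun j => congrFun h0 j) j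

namespace ThreeSATFormula

variable {n m : ℕ} (Φ : ThreeSATFormula n m)

/-- The decimal digits of the members of the family `Φ.numbers`. -/
def digits : (Fin n ⊕ Fin n) ⊕ (Fin m ⊕ Fin m) → Fin (n + m) → ℕ :=
  Sum.elim
    (Sum.elim
      (fun i => Fin.append (fun i' => if i' = i then 1 else 0)
        (fun j => if (i, true) ∈ Φ.clause j then 1 else 0))
      (fun i => Fin.append (fun i' => if i' = i then 1 else 0)
        (fun j => if (i, false) ∈ Φ.clause j then 1 else 0)))
    (Sum.elim (fun j => Fin.append (fun _ => 0) (fun j' => if j' = j then 1 else 0))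
      (fun j => Fin.append (fun _ => 0) (fun j' => if j' = j then 2 else 0)))

theorem numbers_eq_ofDecimal (a : (Fin n ⊕ Fin n) ⊕ (Fin m ⊕ Fin m)) :
    Φ.numbers a = (ofDecimal (Φ.digits a) : ℤ) := by
  rcases a with (i | i) | (j | j) <;> rfl

/-- The number of literals of the clause `j` chosen by `z`. -/
def chosenLiterals {R : Type*} [Semiring R] (j : Fin m)
    (z : (Fin n ⊕ Fin n) ⊕ (Fin m ⊕ Fin m) → R) : R :=
  ∑ l ∈ Φ.clause j, z (Sum.inl (if l.2 then Sum.inl l.1 else Sum.inr l.1))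

theorem chosenLiterals_eq {R : Type*} [Semiring R] (j : Fin m)
    (z : (Fin n ⊕ Fin n) ⊕ (Fin m ⊕ Fin m) → R) :
    Φ.chosenLiterals j z =
      (∑ i, if (i, true) ∈ Φ.clause j then z (Sum.inl (Sum.inl i)) else 0) +
        ∑ i, if (i, false) ∈ Φ.clause j then z (Sum.inl (Sum.inr i)) else 0 := by
  rw [chosenLiterals, ← Finset.univ_inter (Φ.clause j), ← Finset.sum_ite_mem,
    Fintype.sum_prod_type, ← Finset.sum_add_distrib]
  simp

/-- The carry-free digits of `∑ a, Φ.numbers a * z a - target n m`. -/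
def digitDefect (z : (Fin n ⊕ Fin n) ⊕ (Fin m ⊕ Fin m) → ℤ) : Fin (n + m) → ℤ :=
  Fin.append (fun i => z (Sum.inl (Sum.inl i)) + z (Sum.inl (Sum.inr i)) - 1)
    (fun j => Φ.chosenLiterals j z + z (Sum.inr (Sum.inl j)) + 2 * z (Sum.inr (Sum.inr j)) - 4)

theorem sum_numbers_mul_sub_target (z : (Fin n ⊕ Fin n) ⊕ (Fin m ⊕ Fin m) → ℤ) :
    ∑ a, Φ.numbers a * z a - target n m = ∑ p, Φ.digitDefect z p * 10 ^ (p.rev : ℕ) := by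
  have hdig : ∀ p, ∑ a, (Φ.digits a p : ℤ) * z a -
      (Fin.append (fun _ : Fin n => 1) (fun _ : Fin m => 4) p : ℕ) = Φ.digitDefect z p := by
    intro p
    refine Fin.addCases (fun i => ?_) (fun j => ?_) p
    · simp [digits, digitDefect, Fintype.sum_sum_type]
    · simp [digits, digitDefect, Fintype.sum_sum_type, chosenLiterals_eq]
      ring
  simp only [← hdig, numbers_eq_ofDecimal, ofDecimal, target, Nat.cast_sum, Nat.cast_mul,
    Nat.cast_pow, Nat.cast_ofNat, sub_mul, Finset.sum_sub_distrib, Finset.sum_mul]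
  rw [Finset.sum_comm]
  congr 1
  exact Finset.sum_congr rfl fun _ _ => Finset.sum_congr rfl fun _ _ => by ring

/-- No carries occur in the sum of a subfamily of `Φ.numbers`. -/
theorem sum_numbers_mul_eq_target_iff {z : (Fin n ⊕ Fin n) ⊕ (Fin m ⊕ Fin m) → ℤ}
    (hz : ∀ a, z a = 0 ∨ z a = 1) :
    ∑ a, Φ.numbers a * z a = target n m ↔
      (∀ i, z (Sum.inl (Sum.inl i)) + z (Sum.inl (Sum.inr i)) = 1) ∧
      ∀ j, Φ.chosenLiterals j z + z (Sum.inr (Sum.inl j)) + 2 * z (Sum.inr (Sum.inr j)) = 4 := by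
  have hlit : ∀ j, 0 ≤ Φ.chosenLiterals j z ∧ Φ.chosenLiterals j z ≤ 3 := fun j => by
    constructor
    · exact Finset.sum_nonneg fun l _ => by
        rcases hz (Sum.inl (if l.2 then Sum.inl l.1 else Sum.inr l.1)) with h | h <;> simp [h]
    · refine (Finset.sum_le_card_nsmul _ _ 1 fun l _ => ?_).trans ?_
      · rcases hz (Sum.inl (if l.2 then Sum.inl l.1 else Sum.inr l.1)) with h | h <;> simp [h]
      · simpa using Φ.card_clause_le j
  rw [← sub_eq_zero, sum_numbers_mul_sub_target]
  -- Variable defects lie in `[-1, 1]` and clause defects in `[-4, 2]`, as a clause has at most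
  -- three literals.
  have hbound : ∀ p, |Φ.digitDefect z p| ≤ 9 := fun p => by
    refine Fin.addCases (fun i => ?_) (fun j => ?_) p
    · rw [digitDefect, Fin.append_left, abs_le]
      rcases hz (Sum.inl (Sum.inl i)) with h | h <;> rcases hz (Sum.inl (Sum.inr i)) with h' | h' <;>
        rw [h, h'] <;> norm_num
    · rw [digitDefect, Fin.append_right, abs_le]
      have := hlit j
      rcases hz (Sum.inr (Sum.inl j)) with h | h <;> rcases hz (Sum.inr (Sum.inr j)) with h' | h' <;>
        rw [h, h'] <;> constructor <;> linarith
  constructor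
  · intro h
    have h0 := eq_zero_of_sum_mul_ten_pow_eq_zero hbound h
    constructor
    · intro i
      have := congrFun h0 (Fin.castAdd m i)
      rw [digitDefect, Fin.append_left, Pi.zero_apply] at this
      linarith
    · intro j
      have := congrFun h0 (Fin.natAdd n j)
      rw [digitDefect, Fin.append_right, Pi.zero_apply] at this
      linarith
  · rintro ⟨h1, h2⟩
    refine Finset.sum_eq_zero fun p _ => ?_
    refine Fin.addCases (fun i => ?_) (fun j => ?_) p
    · simp [digitDefect, h1]
    · simp [digitDefect, h2]

end ThreeSATFormula

/-! ### Subset sum as a face of knapsack, and auxiliary facts -/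

/-- The part of a convex hull on a supporting hyperplane is spanned by generators. -/
theorem LinearMap.mem_convexHull_of_eq {E : Type*} [AddCommGroup E] [Module ℝ E] {S : Set E}
    {l : E →ₗ[ℝ] ℝ} {M : ℝ} (h : ∀ x ∈ S, l x ≤ M) {x : E} (hx : x ∈ convexHull ℝ S)
    (hlx : l x = M) : x ∈ convexHull ℝ {y ∈ S | l y = M} := by
  have hface : ∀ y ∈ convexHull ℝ {y ∈ S | l y = M}, l y = M := fun y hy =>
    convexHull_min (t := {y | l y = M}) (fun y hy => hy.2) (convex_hyperplane l.isLinear M) hy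
  -- This union contains `S`, so its convexity puts the whole hull of `S` inside it.
  have hconv : Convex ℝ ({y | l y < M} ∪ convexHull ℝ {y ∈ S | l y = M}) := by
    have hmix : ∀ y z : E, l y < M → z ∈ convexHull ℝ {y ∈ S | l y = M} → ∀ s t : ℝ, 0 ≤ s → 0 ≤ t →
        s + t = 1 → s • y + t • z ∈ {y | l y < M} ∪ convexHull ℝ {y ∈ S | l y = M} := by
      intro y z hy hz s t hs ht hst
      rcases hs.eq_or_lt with rfl | hs
      · right
        rwa [zero_smul, zero_add, show t = 1 by linarith, one_smul]
      · left
        have := mul_lt_mul_of_pos_left hy hs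
        have hM : s * M + t * M = M := by rw [← add_mul, hst, one_mul]
        simp only [Set.mem_ofPred_eq, map_add, map_smul, smul_eq_mul, hface z hz]
        linarith
    rintro y (hy | hy) z (hz | hz) s t hs ht hst
    · exact Or.inl (convex_halfSpace_lt l.isLinear M hy hz hs ht hst)
    · exact hmix y z hy hz s t hs ht hst
    · rw [add_comm]
      exact hmix z y hz hy t s ht hs (by linarith)
    · exact Or.inr (convex_convexHull ℝ _ hy hz hs ht hst)
  have hS : S ⊆ {y | l y < M} ∪ convexHull ℝ {y ∈ S | l y = M} := fun y hy =>
    (h y hy).lt_or_eq.imp (fun h => h) fun h => subset_convexHull ℝ _ ⟨hy, h⟩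
  exact (convexHull_min hS hconv hx).resolve_left fun h => h.ne hlx

/-- The linear functional with coefficients `a`. -/
noncomputable def weightFunctional {ι : Type*} [Fintype ι] (a : ι → ℤ) : (ι → ℝ) →ₗ[ℝ] ℝ :=
  ∑ i, (a i : ℝ) • LinearMap.proj i

@[simp]
theorem weightFunctional_apply {ι : Type*} [Fintype ι] (a : ι → ℤ) (x : ι → ℝ) :
    weightFunctional a x = ∑ i, (a i : ℝ) * x i := by
  simp [weightFunctional]

theorem isExposed_knapsackPolytope_subsetSumPolytope {ι : Type*} [Fintype ι] (a : ι → ℤ) (b : ℤ) :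
    IsExposed ℝ (knapsackPolytope a b) (subsetSumPolytope a b) := by
  -- `IsExposed` asks for a functional only when the face is nonempty, so the empty case needs no
  -- argument.
  intro hne
  have hle : ∀ x ∈ knapsackPolytope a b, weightFunctional a x ≤ b := fun x hx =>
    convexHull_min (t := {x | weightFunctional a x ≤ b}) (fun x hx => by simpa using hx.2)
      (convex_halfSpace_le (weightFunctional a).isLinear _) hx
  have hsub : subsetSumPolytope a b ⊆ knapsackPolytope a b :=
    convexHull_mono fun x hx => ⟨hx.1, hx.2.le⟩
  have heq : ∀ x ∈ subsetSumPolytope a b, weightFunctional a x = b := fun x hx =>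
    convexHull_min (t := {x | weightFunctional a x = b}) (fun x hx => by simpa using hx.2)
      (convex_hyperplane (weightFunctional a).isLinear _) hx
  obtain ⟨p, hp⟩ := hne
  refine ⟨LinearMap.toContinuousLinearMap (weightFunctional a), Set.Subset.antisymm
    (fun x hx => ⟨hsub hx, fun y hy => ?_⟩) fun x hx => ?_⟩
  · simpa only [LinearMap.coe_toContinuousLinearMap', heq x hx] using hle y hy
  · have hx' : weightFunctional a x = b := le_antisymm (hle x hx.1) (by
      simpa only [LinearMap.coe_toContinuousLinearMap', heq p hp] using hx.2 p (hsub hp))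
    refine convexHull_mono ?_ (LinearMap.mem_convexHull_of_eq (fun y hy => ?_) hx.1 hx')
    · exact fun y hy => ⟨hy.1.1, by simpa using hy.2⟩
    · simpa using hy.2

theorem image_subsetSumPolytope {ι κ : Type*} [Fintype ι] (a : ι → ℤ) (b : ℤ) (f : κ → ι) :
    (fun (y : ι → ℝ) i => y (f i)) '' subsetSumPolytope a b =
      convexHull ℝ ((fun (y : ι → ℝ) i => y (f i)) ''
        {x | (∀ i, x i = 0 ∨ x i = 1) ∧ ∑ i, (a i : ℝ) * x i = (b : ℝ)}) :=
  (LinearMap.funLeft ℝ ℝ f).image_convexHull _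

theorem exists_finset_equiv {J : Type*} [Fintype J] {w : J → ℤ} (hw : Function.Injective w) :
    ∃ (A : Finset ℤ) (e : J ≃ A), ∀ j, (e j : ℤ) = w j := by
  classical
  refine ⟨Finset.univ.image w, Equiv.ofBijective
    (fun j => ⟨w j, Finset.mem_image_of_mem w (Finset.mem_univ j)⟩)
    ⟨fun i j h => hw (congrArg Subtype.val h), ?_⟩, fun j => rfl⟩
  rintro ⟨a, ha⟩
  obtain ⟨j, -, rfl⟩ := Finset.mem_image.1 ha
  exact ⟨j, rfl⟩

theorem exists_int_cast_of_zero_or_one {J : Type*} {y : J → ℝ} (hy : ∀ a, y a = 0 ∨ y a = 1) :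
    ∃ z : J → ℤ, (∀ a, z a = 0 ∨ z a = 1) ∧ ∀ a, y a = z a := by
  have : ∀ a, ∃ z : ℤ, (z = 0 ∨ z = 1) ∧ y a = z := fun a => by
    rcases hy a with h | h
    · exact ⟨0, Or.inl rfl, by simp [h]⟩
    · exact ⟨1, Or.inr rfl, by simp [h]⟩
  choose z hz using this
  exact ⟨z, fun a => (hz a).1, fun a => (hz a).2⟩

theorem sum_coe_mul_eq_sum_mul_comp {J : Type*} [Fintype J] {w : J → ℤ} {A : Finset ℤ} {e : J ≃ A}
    (he : ∀ j, (e j : ℤ) = w j) (y : A → ℝ) :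
    ∑ a : A, ((a : ℤ) : ℝ) * y a = ∑ j, (w j : ℝ) * y (e j) := by
  rw [← Equiv.sum_comp e]
  simp [he]

/-! ### The projection onto the satisfiability polytope -/

namespace ThreeSATFormula

variable {n m : ℕ} (Φ : ThreeSATFormula n m)

theorem sum_real_eq_target_iff {y : (Fin n ⊕ Fin n) ⊕ (Fin m ⊕ Fin m) → ℝ}
    (hy : ∀ a, y a = 0 ∨ y a = 1) :
    ∑ a, (Φ.numbers a : ℝ) * y a = target n m ↔
      (∀ i, y (Sum.inl (Sum.inl i)) + y (Sum.inl (Sum.inr i)) = 1) ∧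
      ∀ j, Φ.chosenLiterals j y + y (Sum.inr (Sum.inl j)) + 2 * y (Sum.inr (Sum.inr j)) = 4 := by
  obtain ⟨z, hz, hyz⟩ := exists_int_cast_of_zero_or_one hy
  have := Φ.sum_numbers_mul_eq_target_iff hz
  simp only [hyz, chosenLiterals] at this ⊢
  exact_mod_cast this

/-- The two slacks of a clause add up to 0, 1, 2 or 3, so the digit 4 needs at least one true
literal, and any number of true literals from 1 to 3 can be completed. -/
theorem image_solutions_eq_satisfying :
    (fun (y : (Fin n ⊕ Fin n) ⊕ (Fin m ⊕ Fin m) → ℝ) (i : Fin n) => y (Sum.inl (Sum.inl i))) ''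
      {y | (∀ a, y a = 0 ∨ y a = 1) ∧ ∑ a, (Φ.numbers a : ℝ) * y a = (target n m : ℝ)} =
    {x | (∀ i, x i = 0 ∨ x i = 1) ∧ Φ.IsSatisfiedBy x} := by
  ext x
  constructor
  · rintro ⟨y, ⟨hy, hsum⟩, rfl⟩
    obtain ⟨hvar, hcl⟩ := (Φ.sum_real_eq_target_iff hy).1 hsum
    refine ⟨fun i => hy _, fun j => ?_⟩
    by_contra! hj
    have h0 : Φ.chosenLiterals j y = 0 := Finset.sum_eq_zero fun l hl => by
      have hl' := hj l hl
      have hv := hvar l.1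
      rcases l with ⟨i, _ | _⟩
      · rcases hy (Sum.inl (Sum.inl i)) with h | h
        · simp [h] at hl'
        · simp only [h] at hv
          simpa using hv
      · rcases hy (Sum.inl (Sum.inl i)) with h | h
        · simpa using h
        · simp [h] at hl'
    have := hcl j
    rw [h0] at this
    rcases hy (Sum.inr (Sum.inl j)) with h | h <;> rcases hy (Sum.inr (Sum.inr j)) with h' | h' <;>
      rw [h, h'] at this <;> norm_num at this
  · rintro ⟨hx, hsat⟩
    obtain ⟨ζ, hζ, hxζ⟩ := exists_int_cast_of_zero_or_one hx
    let c : Fin m → ℤ := fun j => ∑ l ∈ Φ.clause j, if l.2 then ζ l.1 else 1 - ζ l.1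
    have hterm : ∀ l : Fin n × Bool, 0 ≤ (if l.2 then ζ l.1 else 1 - ζ l.1) ∧
        (if l.2 then ζ l.1 else 1 - ζ l.1) ≤ 1 := by
      rintro ⟨i, _ | _⟩ <;> rcases hζ i with h | h <;> simp [h]
    have hc3 : ∀ j, c j ≤ 3 := fun j =>
      (Finset.sum_le_card_nsmul _ _ 1 fun l _ => (hterm l).2).trans (by
        simpa using Φ.card_clause_le j)
    have hc1 : ∀ j, 1 ≤ c j := fun j => by
      obtain ⟨l, hl, hlx⟩ := hsat j
      refine le_trans ?_ (Finset.single_le_sum (fun l _ => (hterm l).1) hl)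
      rcases l with ⟨i, _ | _⟩ <;> simp only [hxζ] at hlx <;> norm_num at hlx <;> simp [hlx]
    -- A clause with 1, 2 or 3 true literals lacks 3, 2 or 1: take both slacks, only `s'_j`, or only
    -- `s_j`.
    let z : (Fin n ⊕ Fin n) ⊕ (Fin m ⊕ Fin m) → ℤ :=
      Sum.elim (Sum.elim ζ (fun i => 1 - ζ i))
        (Sum.elim (fun j => if c j = 2 then 0 else 1) (fun j => if c j = 3 then 0 else 1))
    have hz : ∀ a, z a = 0 ∨ z a = 1 := by
      rintro ((i | i) | (j | j))
      · exact hζ i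
      · rcases hζ i with h | h <;> simp [z, h]
      · simp only [z, Sum.elim_inr, Sum.elim_inl]
        split_ifs <;> simp
      · simp only [z, Sum.elim_inr]
        split_ifs <;> simp
    have hlit : ∀ j, Φ.chosenLiterals j z = c j := fun j =>
      Finset.sum_congr rfl fun l _ => by split_ifs <;> rfl
    refine ⟨fun a => z a, ⟨fun a => (hz a).imp (fun h => by simp [h]) fun h => by simp [h], ?_⟩,
      funext fun i => (hxζ i).symm⟩
    have := (Φ.sum_numbers_mul_eq_target_iff hz).2 ⟨fun i => by simp [z], fun j => by
      rw [hlit]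
      have h1 := hc1 j
      have h3 := hc3 j
      simp only [z, Sum.elim_inr, Sum.elim_inl]
      split_ifs <;> omega⟩
    dsimp only
    exact_mod_cast this

theorem image_subsetSumPolytope_numbers :
    (fun (y : (Fin n ⊕ Fin n) ⊕ (Fin m ⊕ Fin m) → ℝ) (i : Fin n) => y (Sum.inl (Sum.inl i))) ''
      subsetSumPolytope Φ.numbers (target n m) = Φ.satPolytope := by
  rw [image_subsetSumPolytope, image_solutions_eq_satisfying, satPolytope]

theorem digits_le (a : (Fin n ⊕ Fin n) ⊕ (Fin m ⊕ Fin m)) (p : Fin (n + m)) :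
    Φ.digits a p ≤ 2 := by
  rcases a with (i | i) | (j | j) <;> refine Fin.addCases (fun i => ?_) (fun j => ?_) p <;>
    simp only [digits, Sum.elim_inl, Sum.elim_inr, Fin.append_left, Fin.append_right] <;>
    (try split_ifs) <;> norm_num

theorem digits_eq_of_numbers_eq {a a' : (Fin n ⊕ Fin n) ⊕ (Fin m ⊕ Fin m)}
    (h : Φ.numbers a = Φ.numbers a') (p : Fin (n + m)) : Φ.digits a p = Φ.digits a' p := by
  have h0 := eq_zero_of_sum_mul_ten_pow_eq_zero
    (d := fun p => (Φ.digits a p : ℤ) - Φ.digits a' p) (fun p => by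
      have h1 := Φ.digits_le a p
      have h2 := Φ.digits_le a' p
      rw [abs_le]
      omega) (by
      rw [numbers_eq_ofDecimal, numbers_eq_ofDecimal] at h
      simp only [sub_mul, Finset.sum_sub_distrib]
      rw [sub_eq_zero]
      simpa [ofDecimal] using h)
  have := congrFun h0 p
  simp only [Pi.zero_apply] at this
  omega

theorem numbers_pos (a : (Fin n ⊕ Fin n) ⊕ (Fin m ⊕ Fin m)) : 0 < Φ.numbers a := by
  have key : ∀ p, 0 < Φ.digits a p → 0 < Φ.numbers a := fun p hp => by
    rw [numbers_eq_ofDecimal, Nat.cast_pos]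
    exact Finset.sum_pos' (fun _ _ => Nat.zero_le _) ⟨p, Finset.mem_univ p, by positivity⟩
  rcases a with (i | i) | (j | j)
  · exact key (Fin.castAdd m i) (by simp [digits])
  · exact key (Fin.castAdd m i) (by simp [digits])
  · exact key (Fin.natAdd n j) (by simp [digits])
  · exact key (Fin.natAdd n j) (by simp [digits])

/-- The only coincidences in `Φ.numbers` are between the two literals of a variable. -/
theorem eq_or_of_numbers_eq {a a' : (Fin n ⊕ Fin n) ⊕ (Fin m ⊕ Fin m)}
    (h : Φ.numbers a = Φ.numbers a') :
    a = a' ∨ ∃ i, (∀ j, (i, true) ∈ Φ.clause j ↔ (i, false) ∈ Φ.clause j) ∧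
      (a = Sum.inl (Sum.inl i) ∧ a' = Sum.inl (Sum.inr i) ∨
        a = Sum.inl (Sum.inr i) ∧ a' = Sum.inl (Sum.inl i)) := by
  have hd := Φ.digits_eq_of_numbers_eq h
  have hlit : ∀ {s t : Prop} [Decidable s] [Decidable t],
      ((if s then 1 else 0 : ℕ) = if t then 1 else 0) → (s ↔ t) := by
    intro s t _ _ h
    by_cases hs : s <;> by_cases ht : t <;> simp_all
  rcases a with (i | i) | (j | j) <;> rcases a' with (i' | i') | (j' | j')
  · have := hd (Fin.castAdd m i)
    simp [digits] at this
    simp [this]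
  · have := hd (Fin.castAdd m i)
    simp [digits] at this
    subst this
    exact Or.inr ⟨i, fun j => hlit (by simpa [digits] using hd (Fin.natAdd n j)), Or.inl ⟨rfl, rfl⟩⟩
  · simpa [digits] using hd (Fin.castAdd m i)
  · simpa [digits] using hd (Fin.castAdd m i)
  · have := hd (Fin.castAdd m i)
    simp [digits] at this
    subst this
    exact Or.inr ⟨i, fun j => (hlit (by simpa [digits] using hd (Fin.natAdd n j))).symm,
      Or.inr ⟨rfl, rfl⟩⟩
  · have := hd (Fin.castAdd m i)
    simp [digits] at this
    simp [this]
  · simpa [digits] using hd (Fin.castAdd m i)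
  · simpa [digits] using hd (Fin.castAdd m i)
  · simpa [digits] using hd (Fin.castAdd m i')
  · simpa [digits] using hd (Fin.castAdd m i')
  · have := hd (Fin.natAdd n j)
    simp [digits] at this
    simp [this]
  · have := hd (Fin.natAdd n j)
    simp only [digits, Sum.elim_inl, Sum.elim_inr, Fin.append_right] at this
    split_ifs at this <;> simp_all
  · simpa [digits] using hd (Fin.castAdd m i')
  · simpa [digits] using hd (Fin.castAdd m i')
  · have := hd (Fin.natAdd n j)
    simp only [digits, Sum.elim_inl, Sum.elim_inr, Fin.append_right] at this
    split_ifs at this <;> simp_all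
  · have := hd (Fin.natAdd n j)
    simp [digits] at this
    simp [this]

theorem numbers_injective_iff : Function.Injective Φ.numbers ↔
    ∀ i : Fin n, ∃ j : Fin m, ¬((i, true) ∈ Φ.clause j ↔ (i, false) ∈ Φ.clause j) := by
  constructor
  · intro hinj i
    by_contra! hi
    have : Φ.numbers (Sum.inl (Sum.inl i)) = Φ.numbers (Sum.inl (Sum.inr i)) := by
      simp [numbers, literalNumber, hi]
    simpa using hinj this
  · intro h a a' haa'
    rcases Φ.eq_or_of_numbers_eq haa' with h' | ⟨i, hi, -⟩
    · exact h'
    · obtain ⟨j, hj⟩ := h i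
      exact absurd (hi j) hj

/-- Replacing `v'_i` by `-v'_i` makes the members distinct and complements the choice of `v'_i`. -/
theorem exists_finset_image_subsetSumPolytope_eq :
    ∃ (A : Finset ℤ) (b : ℤ) (σ : Fin n → A), A.card = 2 * n + 2 * m ∧ Function.Injective σ ∧
      (fun (y : A → ℝ) (i : Fin n) => y (σ i)) ''
        subsetSumPolytope (fun a : A => (a : ℤ)) b = Φ.satPolytope := by
  let t : (Fin n ⊕ Fin n) ⊕ (Fin m ⊕ Fin m) → Bool :=
    Sum.elim (Sum.elim (fun _ => false) (fun _ => true)) (fun _ => false)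
  let w : (Fin n ⊕ Fin n) ⊕ (Fin m ⊕ Fin m) → ℤ := fun a =>
    if t a then -Φ.numbers a else Φ.numbers a
  have hw : Function.Injective w := by
    intro a a' h
    -- By positivity the sign of `w a` reveals `t a`, which separates `v_i` from `v'_i`, the only
    -- possible coincidence.
    have hpos := Φ.numbers_pos a
    have hpos' := Φ.numbers_pos a'
    have ht : t a = t a' ∧ Φ.numbers a = Φ.numbers a' := by
      simp only [w] at h
      cases hta : t a <;> cases hta' : t a' <;> simp [hta, hta'] at h ⊢ <;> omega
    rcases Φ.eq_or_of_numbers_eq ht.2 with h' | ⟨i, -, ⟨rfl, rfl⟩ | ⟨rfl, rfl⟩⟩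
    · exact h'
    · simpa [t] using ht.1
    · simpa [t] using ht.1
  obtain ⟨A, e, he⟩ := exists_finset_equiv hw
  -- Since `v (1 - y) = v + (-v) y`, complementing the choice of each `v'_i` lowers the target by
  -- the sum of the `v'_i`.
  let b : ℤ := target n m - ∑ a, if t a then Φ.numbers a else 0
  let flip : ((Fin n ⊕ Fin n) ⊕ (Fin m ⊕ Fin m) → ℝ) → ((Fin n ⊕ Fin n) ⊕ (Fin m ⊕ Fin m) → ℝ) :=
    fun y a => if t a then 1 - y a else y a
  have hflip01 : ∀ y, (∀ a, y a = 0 ∨ y a = 1) → ∀ a, flip y a = 0 ∨ flip y a = 1 := by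
    intro y hy a
    simp only [flip]
    split_ifs <;> rcases hy a with h | h <;> simp [h]
  have hflip : ∀ y, ∑ a, (Φ.numbers a : ℝ) * flip y a = target n m ↔
      ∑ a, (w a : ℝ) * y a = b := by
    intro y
    have : ∑ a, (Φ.numbers a : ℝ) * flip y a =
        ∑ a, (w a : ℝ) * y a + ((∑ a, if t a then Φ.numbers a else 0 : ℤ) : ℝ) := by
      rw [Int.cast_sum, ← Finset.sum_add_distrib]
      refine Finset.sum_congr rfl fun a _ => ?_
      simp only [flip, w]
      split_ifs <;> push_cast <;> ring
    rw [this, Int.cast_sub, eq_sub_iff_add_eq]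
  have hflip2 : ∀ y, flip (flip y) = y := fun y => funext fun a => by
    simp only [flip]
    split_ifs <;> ring
  refine ⟨A, b, fun i => e (Sum.inl (Sum.inl i)), ?_, fun i i' h => by simpa using h, ?_⟩
  · rw [← Fintype.card_coe, ← Fintype.card_congr e]
    simp
    ring
  · rw [image_subsetSumPolytope, satPolytope, ← image_solutions_eq_satisfying]
    congr 1
    ext x
    constructor
    · rintro ⟨y, ⟨hy, hsum⟩, rfl⟩
      rw [sum_coe_mul_eq_sum_mul_comp he] at hsum
      exact ⟨flip (y ∘ e), ⟨hflip01 _ fun a => hy _, (hflip _).2 hsum⟩, rfl⟩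
    · rintro ⟨y, ⟨hy, hsum⟩, rfl⟩
      refine ⟨flip y ∘ e.symm, ⟨fun a => hflip01 y hy _, ?_⟩, funext fun i => by simp [flip, t]⟩
      rw [sum_coe_mul_eq_sum_mul_comp he]
      simp only [Function.comp_apply, Equiv.symm_apply_apply]
      rwa [← hflip, hflip2]

end ThreeSATFormula

/-! ### The correlation formula and the lower bounds -/

namespace ThreeSATFormula

/-- The variables of the formula for the correlation polytope: `b_i` and `z_{i,j}`. -/
noncomputable def correlationVar (k : ℕ) : Fin k ⊕ Fin k × Fin k ≃ Fin (k + k * k) :=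
  Fintype.equivFinOfCardEq (by simp)

/-- The clauses of the formula for the correlation polytope: three for every `z_{i,j}`. -/
noncomputable def correlationIndex (k : ℕ) : Fin (3 * (k * k)) ≃ Fin 3 × Fin k × Fin k :=
  (Fintype.equivFinOfCardEq (by simp)).symm

/-- The formula that says that `z_{i,j} = b_i ∧ b_j` for all `i` and `j`. -/
noncomputable def correlationFormula (k : ℕ) : ThreeSATFormula (k + k * k) (3 * (k * k)) where
  clause c :=
    let v := correlationVar k
    match correlationIndex k c with
    | (0, i, j) => {(v (Sum.inr (i, j)), false), (v (Sum.inl i), true)}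
    | (1, i, j) => {(v (Sum.inr (i, j)), false), (v (Sum.inl j), true)}
    | (2, i, j) => {(v (Sum.inr (i, j)), true), (v (Sum.inl i), false), (v (Sum.inl j), false)}
  card_clause_le c := by
    dsimp only
    split
    · exact Finset.card_le_two.trans (by norm_num)
    · exact Finset.card_le_two.trans (by norm_num)
    · exact Finset.card_le_three

theorem correlationFormula_isSatisfiedBy_iff {k : ℕ} {x : Fin (k + k * k) → ℝ}
    (hx : ∀ i, x i = 0 ∨ x i = 1) :
    (correlationFormula k).IsSatisfiedBy x ↔ ∀ i j, x (correlationVar k (Sum.inr (i, j))) =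
      x (correlationVar k (Sum.inl i)) * x (correlationVar k (Sum.inl j)) := by
  rw [IsSatisfiedBy, (correlationIndex k).symm.surjective.forall]
  simp only [correlationFormula, Equiv.apply_symm_apply, Prod.forall, Fin.forall_fin_succ,
    IsEmpty.forall_iff, and_true]
  simp only [← forall_and]
  refine forall_congr' fun i => forall_congr' fun j => ?_
  rcases hx (correlationVar k (Sum.inr (i, j))) with h | h <;>
    rcases hx (correlationVar k (Sum.inl i)) with h' | h' <;>
    rcases hx (correlationVar k (Sum.inl j)) with h'' | h'' <;> simp [h, h', h'']

/-- The clause `¬z_{i,j} ∨ b_i` contains each of its variables with only one sign. Thus the family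
is already a set of positive integers, and no sign change is needed. -/
theorem correlationFormula_numbers_injective (k : ℕ) :
    Function.Injective (correlationFormula k).numbers := by
  rw [numbers_injective_iff, (correlationVar k).surjective.forall]
  rintro (i | ⟨i, j⟩)
  · refine ⟨(correlationIndex k).symm (0, i, i), ?_⟩
    simp [correlationFormula]
  · refine ⟨(correlationIndex k).symm (0, i, j), ?_⟩
    simp [correlationFormula]

end ThreeSATFormula

-- One system of inequalities and points serves both polytopes: the points lie on the subset-sum
-- face, and the inequalities are valid on the larger knapsack polytope.
open ThreeSATFormula in
theorem exists_le_extensionComplexity_subsetSum_knapsack {k N : ℕ} (hN : 2 ^ k * N < 3 ^ k) :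
    ∃ (A : Finset ℤ) (b : ℤ), (∀ a ∈ A, 0 < a) ∧
      A.card = 2 * (k + k * k) + 2 * (3 * (k * k)) ∧
      (N : ℕ∞) ≤ extensionComplexity (subsetSumPolytope (fun a : A => (a : ℤ)) b) ∧
      (N : ℕ∞) ≤ extensionComplexity (knapsackPolytope (fun a : A => (a : ℤ)) b) := by
  obtain ⟨A, e, he⟩ := exists_finset_equiv (correlationFormula_numbers_injective k)
  set b : ℤ := target (k + k * k) (3 * (k * k)) with hb
  let β : Fin k → A := fun i => e (Sum.inl (Sum.inl (correlationVar k (Sum.inl i))))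
  let ζ : Fin k → Fin k → A := fun i j => e (Sum.inl (Sum.inl (correlationVar k (Sum.inr (i, j)))))
  let S₀ : Set (A → ℝ) := {x | (∀ i, x i = 0 ∨ x i = 1) ∧ ∑ i : A, ((i : ℤ) : ℝ) * x i = (b : ℝ)}
  let S : Set (A → ℝ) := {x | (∀ i, x i = 0 ∨ x i = 1) ∧ ∑ i : A, ((i : ℤ) : ℝ) * x i ≤ (b : ℝ)}
  have hS₀S : S₀ ⊆ S := fun x hx => ⟨hx.1, hx.2.le⟩
  have himage := (correlationFormula k).image_solutions_eq_satisfying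
  have hprod : ∀ y ∈ S₀, ∀ i j, y (ζ i j) = y (β i) * y (β j) := by
    rintro y ⟨hy, hsum⟩
    rw [sum_coe_mul_eq_sum_mul_comp he] at hsum
    have := himage.subset ⟨y ∘ e, ⟨fun a => hy _, hsum⟩, rfl⟩
    exact (correlationFormula_isSatisfiedBy_iff this.1).1 this.2
  have hpoint : ∀ B : Finset (Fin k), ∃ y ∈ S₀, ∀ i, y (β i) = if i ∈ B then 1 else 0 := by
    intro B
    let x : Fin (k + k * k) → ℝ := fun p => Sum.elim (fun i => if i ∈ B then 1 else 0)
      (fun ij => (if ij.1 ∈ B then 1 else 0) * if ij.2 ∈ B then 1 else 0)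
      ((correlationVar k).symm p)
    have hx01 : ∀ p, x p = 0 ∨ x p = 1 := fun p => by
      simp only [x]
      rcases (correlationVar k).symm p with i | ij
      · by_cases hi : i ∈ B <;> simp [hi]
      · by_cases hi : ij.1 ∈ B <;> by_cases hj : ij.2 ∈ B <;> simp [hi, hj]
    obtain ⟨y, ⟨hy, hsum⟩, hyx⟩ := himage.superset
      ⟨hx01, (correlationFormula_isSatisfiedBy_iff hx01).2 fun i j => by simp [x]⟩
    refine ⟨y ∘ e.symm, ⟨fun a => hy _, ?_⟩, fun i => ?_⟩
    · rw [sum_coe_mul_eq_sum_mul_comp he]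
      simpa only [Function.comp_apply, Equiv.symm_apply_apply] using hsum
    · have := congrFun hyx (correlationVar k (Sum.inl i))
      simpa [β, x] using this
  choose x hxS hxβ using hpoint
  let μ : (A → ℝ) →ₗ[ℝ] ℝ := weightFunctional (fun a : A => (a : ℤ))
  let c : Finset (Fin k) → (A → ℝ) →ₗ[ℝ] ℝ := fun a =>
    2 • ∑ i ∈ a, LinearMap.proj (β i) - ∑ i ∈ a, ∑ j ∈ a, LinearMap.proj (ζ i j)
  -- On the face, `c a = 2 s - s ^ 2 = 1 - (s - 1) ^ 2` with `s = ∑ i ∈ a, y (β i)`. Off the face `c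
  -- a` can only be bounded by `2 k`, but there the integral weight is at most `b - 1`, so the
  -- factor `2 k` on `μ` makes up for it.
  let L : Finset (Fin k) → (A → ℝ) →ₗ[ℝ] ℝ := fun a => (2 * k : ℝ) • μ + c a
  have hc : ∀ a y, c a y = 2 * ∑ i ∈ a, y (β i) - ∑ i ∈ a, ∑ j ∈ a, y (ζ i j) := fun a y => by
    simp [c]
  have hL₀ : ∀ a, ∀ y ∈ S₀, L a y = 2 * k * b + 1 - (∑ i ∈ a, y (β i) - 1) ^ 2 := by
    intro a y hy
    have hμ : μ y = b := by simpa [μ] using hy.2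
    have hsq : ∑ i ∈ a, ∑ j ∈ a, y (ζ i j) = (∑ i ∈ a, y (β i)) * ∑ i ∈ a, y (β i) := by
      rw [Finset.sum_mul_sum]
      exact Finset.sum_congr rfl fun i _ => Finset.sum_congr rfl fun j _ => hprod y hy i j
    simp only [L, LinearMap.add_apply, LinearMap.smul_apply, smul_eq_mul, hμ, hc, hsq]
    ring
  have hL : ∀ a, ∀ y ∈ S, L a y ≤ 2 * k * b + 1 := by
    rintro a y ⟨hy, hle⟩
    rcases hle.eq_or_lt with heq | hlt
    · rw [hL₀ a y ⟨hy, heq⟩]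
      nlinarith [sq_nonneg (∑ i ∈ a, y (β i) - 1)]
    · have hμ : μ y ≤ b - 1 := by
        obtain ⟨z, -, hz⟩ := exists_int_cast_of_zero_or_one hy
        have hμz : μ y = ((∑ i : A, (i : ℤ) * z i : ℤ) : ℝ) := by simp [μ, hz]
        have hlt' : ((∑ i : A, (i : ℤ) * z i : ℤ) : ℝ) < (b : ℝ) := by
          rw [← hμz]
          simpa [μ] using hlt
        rw [hμz]
        exact_mod_cast Int.le_sub_one_of_lt (Int.cast_lt.1 hlt')
      have hβ : ∑ i ∈ a, y (β i) ≤ k := by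
        refine (Finset.sum_le_card_nsmul a _ 1 fun i _ => ?_).trans ?_
        · rcases hy (β i) with h | h <;> simp [h]
        · simpa using Finset.card_le_univ a
      have hζ : 0 ≤ ∑ i ∈ a, ∑ j ∈ a, y (ζ i j) :=
        Finset.sum_nonneg fun i _ => Finset.sum_nonneg fun j _ => by
          rcases hy (ζ i j) with h | h <;> simp [h]
      have := mul_le_mul_of_nonneg_left hμ (by positivity : (0 : ℝ) ≤ 2 * k)
      simp only [L, LinearMap.add_apply, LinearMap.smul_apply, smul_eq_mul, hc]
      linarith
  have htight : ∀ a B, L a (x B) = 2 * k * b + 1 ↔ (a ∩ B).card = 1 := by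
    intro a B
    have hcard : ∑ i ∈ a, x B (β i) = (a ∩ B).card := by
      simp [hxβ]
    rw [hL₀ a _ (hxS B), hcard, sub_eq_self, sq_eq_zero_iff, sub_eq_zero, Nat.cast_eq_one]
  refine ⟨A, b, fun a ha => ?_, ?_, ?_, ?_⟩
  · obtain ⟨j, hj⟩ := e.surjective ⟨a, ha⟩
    have := numbers_pos (correlationFormula k) j
    rwa [← he j, hj] at this
  · rw [← Fintype.card_coe, ← Fintype.card_congr e]
    simp
    ring
  · exact le_extensionComplexity_convexHull hxS (fun a y hy => hL a y (hS₀S hy)) htight hN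
  · exact le_extensionComplexity_convexHull (fun B => hS₀S (hxS B)) hL htight hN

theorem mainTheorem6 :
    -- the base-10 reduction: `SAT(Φ)` is the projection of `SUBSETSUM(A(Φ), b)` to the
    -- coordinates of `v_1, …, v_n`
    (∀ (n m : ℕ) (Φ : ThreeSATFormula n m),
      Fintype.card ((Fin n ⊕ Fin n) ⊕ (Fin m ⊕ Fin m)) = 2 * n + 2 * m ∧
      (fun (y : (Fin n ⊕ Fin n) ⊕ (Fin m ⊕ Fin m) → ℝ) (i : Fin n) => y (Sum.inl (Sum.inl i))) ''
          subsetSumPolytope Φ.numbers (ThreeSATFormula.target n m) = Φ.satPolytope ∧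
      (Function.Injective Φ.numbers ↔
        ∀ i : Fin n, ∃ j : Fin m, ¬((i, true) ∈ Φ.clause j ↔ (i, false) ∈ Φ.clause j))) ∧
    -- every `SAT(Φ)` is a coordinate projection for a set of exactly `2n + 2m` integers
    (∀ (n m : ℕ) (Φ : ThreeSATFormula n m),
      ∃ (A : Finset ℤ) (b : ℤ) (σ : Fin n → A), A.card = 2 * n + 2 * m ∧ Function.Injective σ ∧
        (fun (y : A → ℝ) (i : Fin n) => y (σ i)) ''
          subsetSumPolytope (fun a : A => (a : ℤ)) b = Φ.satPolytope) ∧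
    -- the subset-sum polytope is a face of the knapsack polytope
    (∀ (ι : Type) [Fintype ι] (a : ι → ℤ) (b : ℤ),
      IsExposed ℝ (knapsackPolytope a b) (subsetSumPolytope a b)) ∧
    -- the lower bounds on the extension complexity
    (∃ (c : ℝ) (C : ℕ), 0 < c ∧ ∀ n : ℕ, 1 ≤ n →
      ∃ (A : Finset ℤ) (b : ℤ), (∀ a ∈ A, 0 < a) ∧ A.card ≤ C * n ∧
        ENNReal.ofReal ((2 : ℝ) ^ (c * Real.sqrt n)) ≤
          ((extensionComplexity (subsetSumPolytope (fun a : A => (a : ℤ)) b) : ℕ∞) : ℝ≥0∞) ∧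
        ENNReal.ofReal ((2 : ℝ) ^ (c * Real.sqrt n)) ≤
          ((extensionComplexity (knapsackPolytope (fun a : A => (a : ℤ)) b) : ℕ∞) : ℝ≥0∞)) := by

  refine ⟨fun n m Φ => ⟨by simp; ring, Φ.image_subsetSumPolytope_numbers, Φ.numbers_injective_iff⟩,
    fun n m Φ => Φ.exists_finset_image_subsetSumPolytope_eq,
    fun ι _ a b => isExposed_knapsackPolytope_subsetSumPolytope a b, 1, 160, one_pos,
    fun n hn => ?_⟩
  -- With `k = 2 r` and `N = 2 ^ r` the required inequality is `8 ^ r < 9 ^ r`, and `r ≥ √n` gives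
  -- `c = 1`.
  set r := Nat.sqrt n + 1 with hr
  have hpow : 2 ^ (2 * r) * 2 ^ r < 3 ^ (2 * r) := by
    rw [pow_mul, pow_mul, ← mul_pow]
    exact Nat.pow_lt_pow_left (by norm_num) (by omega)
  obtain ⟨A, b, hpos, hcard, hS, hK⟩ := exists_le_extensionComplexity_subsetSum_knapsack hpow
  have hle : ENNReal.ofReal ((2 : ℝ) ^ (1 * Real.sqrt n)) ≤ (((2 ^ r : ℕ) : ℕ∞) : ℝ≥0∞) := by
    have hsqrt : Real.sqrt n ≤ r := by
      rw [Real.sqrt_le_left (Nat.cast_nonneg r)]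
      have := Nat.lt_succ_sqrt' n
      exact_mod_cast this.le
    rw [one_mul, ENat.toENNReal_coe]
    refine ENNReal.ofReal_le_natCast.2 ?_
    push_cast
    rw [← Real.rpow_natCast]
    exact Real.rpow_le_rpow_of_exponent_le (by norm_num) hsqrt
  refine ⟨A, b, hpos, ?_, hle.trans (ENat.toENNReal_le.2 hS), hle.trans (ENat.toENNReal_le.2 hK)⟩
  have h1 : Nat.sqrt n * Nat.sqrt n ≤ n := Nat.sqrt_le n
  have h2 : 1 ≤ Nat.sqrt n := Nat.sqrt_pos.2 hn
  -- The cardinality is `4 r + 32 r ^ 2`; since `r ≤ 2 * Nat.sqrt n`, it is at most `136 n`, within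
  -- `160 n`.
  rw [hcard]
  nlinarith
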